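/- **Theorem 2.1.** Let $n\ge 1$ be an integer and let $b\neq 0$ be an integer. There is a constant $C$, depending only on $n$ and $b$, such that for every compact convex set $\Delta\subset\mathbb{R}^n$ with nonempty interior and Euclidean diameter $\omega\ge 1$, the set $$\Delta_b=\{x=(x_1,\dots,x_n)\in\Delta\cap\mathbb{Z}^n:\ \gcd(x_1,\dots,x_n,b)=1\}$$ is finite and $$\left|\,|\Delta_b|-\Bigl(\prod_{p\mid b}\bigl(1-p^{-n}\bigr)\Bigr)\operatorname{vol}(\Delta)\right|\le C\,\omega^{\,n-1},$$ where the product runs over the distinct primes $p$ dividing $b$ and $\operatorname{vol}$ is Lebesgue measure on $\mathbb{R}^n$. -/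

import Mathlib

open MeasureTheory

/-- A convex domain of `ℝⁿ`: a compact convex set of full dimension (nonempty interior). -/
structure IsConvexDomain {n : ℕ} (Δ : Set (EuclideanSpace ℝ (Fin n))) : Prop where
  convex : Convex ℝ Δ
  isCompact : IsCompact Δ
  nonempty_interior : (interior Δ).Nonempty

/-- The integer vector `x ∈ ℤⁿ` seen as a point of Euclidean space `ℝⁿ`. -/
def latticePoint {n : ℕ} (x : Fin n → ℤ) : EuclideanSpace ℝ (Fin n) :=
  WithLp.toLp 2 (fun i => (x i : ℝ))

/-- `gcd(x₁, …, xₙ, b)`, as a natural number. -/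
def gcdWith {n : ℕ} (x : Fin n → ℤ) (b : ℤ) : ℕ :=
  Int.gcd (Finset.univ.gcd x) b

/-- The set `Δ₁` of lattice points of `Δ`, given by their integer coordinate vectors. -/
def latticePoints {n : ℕ} (Δ : Set (EuclideanSpace ℝ (Fin n))) : Set (Fin n → ℤ) :=
  {x | latticePoint x ∈ Δ}

/-- The set `Δ_b` of lattice points `x` of `Δ` with `gcd(x₁, …, xₙ, b) = 1`. -/
def coprimePoints {n : ℕ} (Δ : Set (EuclideanSpace ℝ (Fin n))) (b : ℤ) : Set (Fin n → ℤ) :=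
  {x ∈ latticePoints Δ | gcdWith x b = 1}

/-! Inclusion–exclusion over sets `s` of primes dividing `b` reduces the count to lattice points of
`Δ` with all coordinates divisible by `d = ∏ p ∈ s, p`. These correspond to the integer points of
`d⁻¹Δ`, which has volume `vol Δ / dⁿ`, and the signed sum of the factors `1 / dⁿ` is the Euler
product.

The error comes from `abs_ncard_integerPoints_sub_volume_le`: a compact convex set in a cube of side
`L` has as many integer points as its volume, up to `n (L + 1) ^ (n - 1)`. Its induction on
dimension sums over integer slices; the sum of slice volumes is compared with the full volume by
Fubini and the one-dimensional count along each line. -/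

theorem abs_ncard_intCast_preimage_sub_volume_le {S : Set ℝ} (hc : Convex ℝ S)
    (hS : IsCompact S) : |(({t : ℤ | (t : ℝ) ∈ S}).ncard : ℝ) - volume.real S| ≤ 1 := by
  rcases S.eq_empty_or_nonempty with rfl | hne
  · simp
  obtain ⟨u, v, huv⟩ : ∃ u v, S = Set.Icc u v :=
    ⟨_, _, eq_Icc_of_connected_compact ⟨hne, hc.isPreconnected⟩ hS⟩
  subst huv
  have huv : u ≤ v := Set.nonempty_Icc.1 hne
  have h1 : {t : ℤ | (t : ℝ) ∈ Set.Icc u v} = ↑(Finset.Icc ⌈u⌉ ⌊v⌋) := by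
    ext t; simp [Int.ceil_le, Int.le_floor]
  rw [h1, Set.ncard_coe_finset, Int.card_Icc, Real.volume_real_Icc_of_le huv]
  -- Even if the interval contains no integer, `⌊v⌋ + 1 - ⌈u⌉` is nonnegative, so `toNat` truncates
  -- nothing.
  have h2 : ⌈u⌉ ≤ ⌊v⌋ + 1 := by
    have h3 := Int.ceil_lt_add_one u
    have h4 := Int.lt_floor_add_one v
    by_contra! h5
    have : ((⌊v⌋ + 2 : ℤ) : ℝ) ≤ ⌈u⌉ := by exact_mod_cast (by omega : ⌊v⌋ + 2 ≤ ⌈u⌉)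
    push_cast at this
    linarith
  have h3 : (((⌊v⌋ + 1 - ⌈u⌉).toNat : ℤ) : ℝ) = ⌊v⌋ + 1 - ⌈u⌉ := by
    rw [Int.toNat_of_nonneg (by omega)]; push_cast; ring
  rw [Int.cast_natCast] at h3
  rw [h3, abs_le]
  have := Int.ceil_lt_add_one u
  have := Int.le_ceil u
  have := Int.lt_floor_add_one v
  have := Int.floor_le v
  constructor <;> linarith

/-- By Fubini both quantities are integrals over `y ∈ B`, and the integrands differ by at most `c`
on each line. -/
theorem abs_sum_measureReal_slice_sub_prod_le {Y : Type*} [MeasurableSpace Y] {ν : Measure Y}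
    [SFinite ν] {S : Set (ℝ × Y)} (hS : MeasurableSet S) (hSf : (volume.prod ν) S ≠ ⊤)
    {B : Set Y} (hBf : ν B ≠ ⊤) (hSB : ∀ t y, (t, y) ∈ S → y ∈ B)
    (T : Finset ℤ) {c : ℝ}
    (h : ∀ y, |∑ t ∈ T, Set.indicator {y | ((t : ℝ), y) ∈ S} (fun _ => (1 : ℝ)) y -
      volume.real {t | (t, y) ∈ S}| ≤ c) :
    |∑ t ∈ T, ν.real {y | ((t : ℝ), y) ∈ S} - (volume.prod ν).real S| ≤ c * ν.real B := by
  have hm : ∀ t : ℝ, MeasurableSet {y | (t, y) ∈ S} := fun t => measurable_prodMk_left hS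
  have hsub : ∀ t : ℝ, {y | (t, y) ∈ S} ⊆ B := fun t y hy => hSB t y hy
  have hSi : Integrable (S.indicator (fun _ => (1 : ℝ))) (volume.prod ν) :=
    (integrable_indicator_iff hS).2 (integrableOn_const hSf)
  have hslice : ∀ y, ∫ t : ℝ, S.indicator (fun _ => (1 : ℝ)) (t, y) =
      volume.real {t | (t, y) ∈ S} := by
    intro y
    have hmy : MeasurableSet {t : ℝ | (t, y) ∈ S} := measurable_prodMk_right hS
    rw [← integral_indicator_one hmy]
    rfl
  have h1 : (volume.prod ν).real S = ∫ y in B, volume.real {t | (t, y) ∈ S} ∂ν := by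
    rw [setIntegral_eq_integral_of_forall_compl_eq_zero]
    · rw [← integral_indicator_one hS]
      refine (integral_prod_symm _ hSi).trans ?_
      exact integral_congr_ae (.of_forall hslice)
    · intro y hy
      have : {t | (t, y) ∈ S} = ∅ := by
        ext t; simpa using fun h => hy (hSB t y h)
      simp [this]
  have h1i : Integrable (fun y => volume.real {t | (t, y) ∈ S}) ν := by
    simpa only [hslice] using hSi.integral_prod_right
  have h2 : ∀ t : ℝ, ν.real {y | (t, y) ∈ S} =
      ∫ y in B, Set.indicator {y | (t, y) ∈ S} (fun _ => (1 : ℝ)) y ∂ν := by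
    intro t
    rw [setIntegral_indicator (hm t), Set.inter_eq_right.2 (hsub t)]
    simp
  have h2i : ∀ t : ℝ, IntegrableOn (Set.indicator {y | (t, y) ∈ S} (fun _ => (1 : ℝ))) B ν :=
    fun t => (integrableOn_const hBf).indicator (hm t)
  simp_rw [h1, h2]
  rw [← integral_finsetSum T (fun (t : ℤ) _ => h2i t),
    ← integral_sub (integrable_finsetSum T fun (t : ℤ) _ => h2i t) h1i.integrableOn]
  rw [← Real.norm_eq_abs]
  refine norm_setIntegral_le_of_norm_le_const (lt_top_iff_ne_top.2 hBf) fun y _ => ?_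
  simpa only [Real.norm_eq_abs] using h y

/-! ### Integer points of convex bodies -/

/-- The integer points of a subset of `ℝⁿ`. -/
def integerPoints {n : ℕ} (K : Set (Fin n → ℝ)) : Set (Fin n → ℤ) :=
  {x | (fun i => (x i : ℝ)) ∈ K}

theorem integerPoints_finite {n : ℕ} {K : Set (Fin n → ℝ)} {a b : Fin n → ℝ}
    (h : K ⊆ Set.Icc a b) : (integerPoints K).Finite := by
  refine (Set.finite_Icc (fun i => ⌈a i⌉) (fun i => ⌊b i⌋)).subset fun x hx => ?_
  have := h hx
  exact ⟨fun i => Int.ceil_le.2 (this.1 i), fun i => Int.le_floor.2 (this.2 i)⟩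

theorem ncard_integerPoints_succ {n : ℕ} {K : Set (Fin (n + 1) → ℝ)}
    {a b : Fin (n + 1) → ℝ} (h : K ⊆ Set.Icc a b) :
    (integerPoints K).ncard = ∑ t ∈ Finset.Icc ⌈a 0⌉ ⌊b 0⌋,
      (integerPoints {y | (Fin.cons (t : ℝ) y : Fin (n + 1) → ℝ) ∈ K}).ncard := by
  classical
  have hf := integerPoints_finite h
  rw [Set.ncard_eq_toFinset_card _ hf, Finset.card_eq_sum_card_fiberwise (f := fun x => x 0)
    (t := Finset.Icc ⌈a 0⌉ ⌊b 0⌋)]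
  · refine Finset.sum_congr rfl fun t _ => ?_
    rw [← Set.ncard_coe_finset]
    have : (↑{x ∈ hf.toFinset | x 0 = t} : Set (Fin (n + 1) → ℤ)) =
        (fun y : Fin n → ℤ => (Fin.cons t y : Fin (n + 1) → ℤ)) ''
          integerPoints {y | (Fin.cons (t : ℝ) y : Fin (n + 1) → ℝ) ∈ K} := by
      have key : ∀ y : Fin n → ℤ, (fun i => (((Fin.cons t y : Fin (n + 1) → ℤ) i : ℤ) : ℝ)) =
          (Fin.cons (t : ℝ) (fun i => (y i : ℝ)) : Fin (n + 1) → ℝ) := by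
        intro y; ext i; refine Fin.cases ?_ (fun j => ?_) i <;> simp
      ext x
      simp only [Finset.coe_filter, Set.Finite.mem_toFinset, Set.mem_ofPred_eq, Set.mem_image,
        integerPoints]
      constructor
      · rintro ⟨hx, rfl⟩
        refine ⟨Fin.tail x, ?_, Fin.cons_self_tail x⟩
        rw [← key, Fin.cons_self_tail]; exact hx
      · rintro ⟨y, hy, rfl⟩
        rw [← key] at hy
        exact ⟨hy, rfl⟩
    rw [this, Set.ncard_image_of_injective _ (fun y z h => Fin.cons_right_injective (α := fun _ => ℤ) t h)]
  · intro x hx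
    have := h (hf.mem_toFinset.1 hx)
    exact Finset.mem_coe.2 (Finset.mem_Icc.2
      ⟨Int.ceil_le.2 (this.1 0), Int.le_floor.2 (this.2 0)⟩)

theorem card_Icc_ceil_floor_le {a L : ℝ} (hL : 0 ≤ L) :
    ((Finset.Icc ⌈a⌉ ⌊a + L⌋).card : ℝ) ≤ L + 1 := by
  rw [Int.card_Icc]
  have h : (((⌊a + L⌋ + 1 - ⌈a⌉).toNat : ℤ) : ℝ) = max ((⌊a + L⌋ : ℝ) + 1 - ⌈a⌉) 0 := by
    rw [Int.toNat_eq_max]; push_cast; rfl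
  rw [Int.cast_natCast] at h
  rw [h]
  have := Int.le_ceil a
  have := Int.floor_le (a + L)
  exact max_le (by linarith) (by linarith)

theorem Convex.cons_left_slice {n : ℕ} {K : Set (Fin (n + 1) → ℝ)} (hK : Convex ℝ K) (t : ℝ) :
    Convex ℝ {y : Fin n → ℝ | (Fin.cons t y : Fin (n + 1) → ℝ) ∈ K} := by
  intro x hx y hy p q hp hq hpq
  have := hK hx hy hp hq hpq
  rw [Set.mem_ofPred_eq]
  convert this using 1
  ext i
  refine Fin.cases ?_ (fun j => ?_) i
  · simp [← add_mul, hpq]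
  · simp

theorem Convex.cons_right_slice {n : ℕ} {K : Set (Fin (n + 1) → ℝ)} (hK : Convex ℝ K)
    (y : Fin n → ℝ) : Convex ℝ {t : ℝ | (Fin.cons t y : Fin (n + 1) → ℝ) ∈ K} := by
  intro s hs t ht p q hp hq hpq
  have := hK hs ht hp hq hpq
  rw [Set.mem_ofPred_eq]
  convert this using 1
  ext i
  refine Fin.cases ?_ (fun j => ?_) i
  · simp
  · simp [← add_mul, hpq]

/-- From dimension `n` to `n + 1`, at most `L + 1` slices each contribute `n (L + 1) ^ (n - 1)`, and
the Fubini comparison adds `L ^ n ≤ (L + 1) ^ n`. -/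
theorem abs_ncard_integerPoints_sub_volume_le {n : ℕ} {K : Set (Fin n → ℝ)} (hc : Convex ℝ K)
    (hK : IsCompact K) {a : Fin n → ℝ} {L : ℝ} (hL : 0 ≤ L)
    (hbox : K ⊆ Set.Icc a (fun i => a i + L)) :
    |((integerPoints K).ncard : ℝ) - volume.real K| ≤ n * (L + 1) ^ (n - 1) := by
  induction n with
  | zero =>
    rcases Set.eq_empty_or_nonempty K with rfl | hne
    · simp [integerPoints]
    · have hKu : K = Set.univ := Subsingleton.eq_univ_of_nonempty hne
      have h1 : integerPoints (Set.univ : Set (Fin 0 → ℝ)) = {0} := by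
        ext x; simpa [integerPoints] using Subsingleton.elim x 0
      rw [hKu, h1]
      simp [Measure.real, volume_pi]
  | succ n ih =>
    set e := MeasurableEquiv.piFinSuccAbove (fun _ : Fin (n + 1) => ℝ) 0 with he
    have hmp : MeasurePreserving e volume (volume.prod volume) :=
      volume_preserving_piFinSuccAbove (fun _ : Fin (n + 1) => ℝ) 0
    have hesymm : ∀ t y, e.symm (t, y) = (Fin.cons t y : Fin (n + 1) → ℝ) := fun t y => by
      simp [he, MeasurableEquiv.piFinSuccAbove, Fin.consEquiv]
    set S : Set (ℝ × (Fin n → ℝ)) := e.symm ⁻¹' K with hSdef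
    have hmemS : ∀ t y, (t, y) ∈ S ↔ (Fin.cons t y : Fin (n + 1) → ℝ) ∈ K := fun t y => by
      rw [hSdef, Set.mem_preimage, hesymm]
    have hSm : MeasurableSet S := e.symm.measurable hK.measurableSet
    have hSv : (volume.prod volume) S = volume K :=
      (hmp.symm e).measure_preimage_equiv K
    have hbox' : ∀ t y, (Fin.cons t y : Fin (n + 1) → ℝ) ∈ K →
        (t ∈ Set.Icc (a 0) (a 0 + L)) ∧
          y ∈ Set.Icc (Fin.tail a) (fun i => Fin.tail a i + L) := by
      intro t y h
      have := hbox h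
      exact ⟨⟨this.1 0, this.2 0⟩, fun i => this.1 i.succ, fun i => this.2 i.succ⟩
    have hcompR : ∀ y : Fin n → ℝ, IsCompact {t : ℝ | (Fin.cons t y : Fin (n + 1) → ℝ) ∈ K} :=
      fun y => isCompact_Icc.of_isClosed_subset
        (hK.isClosed.preimage (by fun_prop)) fun t ht => (hbox' t y ht).1
    have hcompL : ∀ t : ℝ, IsCompact {y : Fin n → ℝ | (Fin.cons t y : Fin (n + 1) → ℝ) ∈ K} :=
      fun t => isCompact_Icc.of_isClosed_subset
        (hK.isClosed.preimage (by fun_prop)) fun y hy => (hbox' t y hy).2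
    have hfub := abs_sum_measureReal_slice_sub_prod_le (ν := volume) hSm
      (by rw [hSv]; exact hK.measure_lt_top.ne)
      (B := Set.Icc (Fin.tail a) (fun i => Fin.tail a i + L))
      isCompact_Icc.measure_lt_top.ne (fun t y h => (hbox' t y ((hmemS t y).1 h)).2)
      (Finset.Icc ⌈a 0⌉ ⌊a 0 + L⌋) (c := 1) (by
        intro y
        convert abs_ncard_intCast_preimage_sub_volume_le (hc.cons_right_slice y) (hcompR y)
          using 3
        · classical
          simp only [Set.indicator_apply, Set.mem_ofPred_eq, hmemS]
          rw [Finset.sum_boole, ← Set.ncard_coe_finset]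
          congr 2
          ext t
          simp only [Finset.coe_filter, Set.mem_ofPred_eq, and_iff_right_iff_imp]
          intro ht
          have := (hbox' _ _ ht).1
          exact Finset.mem_Icc.2 ⟨Int.ceil_le.2 this.1, Int.le_floor.2 this.2⟩
        · simp only [hmemS])
    have hBv : volume.real (Set.Icc (Fin.tail a) (fun i => Fin.tail a i + L)) = L ^ n := by
      rw [Measure.real, Real.volume_Icc_pi_toReal]
      · simp
      · intro i; simpa using hL
    rw [hBv, one_mul, measureReal_def (volume.prod volume), hSv, ← measureReal_def] at hfub
    have hsum : |((integerPoints K).ncard : ℝ) - ∑ t ∈ Finset.Icc ⌈a 0⌉ ⌊a 0 + L⌋,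
        volume.real {y | ((t : ℝ), y) ∈ S}| ≤ n * (L + 1) ^ n := by
      rw [ncard_integerPoints_succ hbox, Nat.cast_sum, ← Finset.sum_sub_distrib]
      refine (Finset.abs_sum_le_sum_abs _ _).trans ?_
      have : ∀ t ∈ Finset.Icc ⌈a 0⌉ ⌊a 0 + L⌋,
          |((integerPoints {y | (Fin.cons (t : ℝ) y : Fin (n + 1) → ℝ) ∈ K}).ncard : ℝ) -
            volume.real {y | ((t : ℝ), y) ∈ S}| ≤ n * (L + 1) ^ (n - 1) := by
        intro t _
        simp only [hmemS]
        exact ih (hc.cons_left_slice t) (hcompL t) fun y hy => (hbox' t y hy).2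
      refine (Finset.sum_le_card_nsmul _ _ _ this).trans ?_
      rw [nsmul_eq_mul]
      refine (mul_le_mul_of_nonneg_right (card_Icc_ceil_floor_le hL) (by positivity)).trans ?_
      -- For `n = 0` the exponent `n - 1` truncates to `0`, but the factor `n` makes both sides
      -- vanish.
      cases n with
      | zero => simp
      | succ m => exact le_of_eq (by simp only [Nat.add_sub_cancel]; ring)
    have hpow : L ^ n ≤ (L + 1) ^ n := pow_le_pow_left₀ hL (by linarith) n
    rw [Nat.add_sub_cancel]
    push_cast
    refine (abs_sub_le _ _ _).trans ((add_le_add hsum hfub).trans ?_)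
    linarith

/-! ### Inclusion–exclusion over the primes dividing `b` -/

theorem gcdWith_eq_one_iff {n : ℕ} (x : Fin n → ℤ) {b : ℤ} (hb : b ≠ 0) :
    gcdWith x b = 1 ↔ ∀ p ∈ b.natAbs.primeFactors, ¬ ∀ i, (p : ℤ) ∣ x i := by
  have hdvd : ∀ p : ℕ, (∀ i, (p : ℤ) ∣ x i) ↔ (p : ℤ) ∣ Finset.univ.gcd x := fun p => by
    simp [Finset.dvd_gcd_iff]
  simp only [hdvd, gcdWith]
  constructor
  · intro h p hp hpx
    have hpb : (p : ℤ) ∣ b := Int.natCast_dvd.2 (Nat.dvd_of_mem_primeFactors hp)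
    have := Int.dvd_coe_gcd hpx hpb
    rw [h] at this
    exact (Nat.prime_of_mem_primeFactors hp).one_lt.ne' (Nat.dvd_one.1 (by exact_mod_cast this))
  · intro h
    by_contra hne
    obtain ⟨p, hp, hpd⟩ := Nat.exists_prime_and_dvd hne
    have hpd' : (p : ℤ) ∣ (Int.gcd (Finset.univ.gcd x) b : ℤ) := Int.natCast_dvd_natCast.2 hpd
    refine h p (Nat.mem_primeFactors.2 ⟨hp, ?_, Int.natAbs_ne_zero.2 hb⟩)
      (hpd'.trans (Int.gcd_dvd_left _ _))
    exact Int.natCast_dvd.1 (hpd'.trans (Int.gcd_dvd_right _ _))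

theorem prod_primes_dvd_iff_forall_dvd {s : Finset ℕ} (hs : ∀ p ∈ s, p.Prime) (m : ℤ) :
    ((∏ p ∈ s, p : ℕ) : ℤ) ∣ m ↔ ∀ p ∈ s, (p : ℤ) ∣ m := by
  constructor
  · exact fun h p hp => (Int.natCast_dvd_natCast.2 (Finset.dvd_prod_of_mem _ hp)).trans h
  · intro h
    rw [Int.natCast_dvd]
    exact Finset.prod_primes_dvd _ (fun p hp => (hs p hp).prime)
      fun p hp => Int.natCast_dvd.1 (h p hp)

/-- Expand the product over `p ∈ P` of one minus the indicator of `p` dividing every coordinate;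
distinct primes all divide an integer exactly when their product does. -/
theorem indicator_coprime_eq_sum {n : ℕ} {P : Finset ℕ} (hP : ∀ p ∈ P, p.Prime)
    (x : Fin n → ℤ) :
    open Classical in
    (if ∀ p ∈ P, ¬ ∀ i, (p : ℤ) ∣ x i then (1 : ℝ) else 0) =
      ∑ s ∈ P.powerset, (-1 : ℝ) ^ s.card *
        if ∀ i, ((∏ p ∈ s, p : ℕ) : ℤ) ∣ x i then 1 else 0 := by
  classical
  have h1 : (if ∀ p ∈ P, ¬ ∀ i, (p : ℤ) ∣ x i then (1 : ℝ) else 0) =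
      ∏ p ∈ P, (1 + -(if ∀ i, (p : ℤ) ∣ x i then (1 : ℝ) else 0)) := by
    rw [← Finset.prod_boole]
    refine Finset.prod_congr rfl fun p _ => ?_
    by_cases h : ∀ i, (p : ℤ) ∣ x i <;> simp [h]
  rw [h1, Finset.prod_one_add]
  refine Finset.sum_congr rfl fun s hs => ?_
  rw [Finset.prod_neg, Finset.prod_boole]
  congr 2
  simp only [prod_primes_dvd_iff_forall_dvd
    fun p hp => hP p (Finset.mem_powerset.1 hs hp)]
  exact propext ⟨fun h i p hp => h p hp i, fun h p hp i => h i p hp⟩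

theorem prod_one_sub_inv_pow_eq_sum (P : Finset ℕ) (n : ℕ) :
    ∏ p ∈ P, (1 - 1 / (p : ℝ) ^ n) =
      ∑ s ∈ P.powerset, (-1 : ℝ) ^ s.card * (1 / ((∏ p ∈ s, p : ℕ) : ℝ) ^ n) := by
  simp only [sub_eq_add_neg]
  rw [Finset.prod_one_add]
  refine Finset.sum_congr rfl fun s _ => ?_
  rw [Finset.prod_neg]
  simp [Finset.prod_pow]

/-! ### Rescaling by `d` and the final estimate -/

/-- The real points `y` such that `d • y` lies in `Δ`. -/
def scaledDomain {n : ℕ} (Δ : Set (EuclideanSpace ℝ (Fin n))) (d : ℕ) : Set (Fin n → ℝ) :=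
  WithLp.toLp 2 ⁻¹' (((d : ℝ) • ·) ⁻¹' Δ)

theorem volume_real_scaledDomain {n : ℕ} {Δ : Set (EuclideanSpace ℝ (Fin n))}
    {d : ℕ} (hd : d ≠ 0) :
    volume.real (scaledDomain Δ d) = 1 / (d : ℝ) ^ n * (volume Δ).toReal := by
  have hd' : (d : ℝ) ≠ 0 := Nat.cast_ne_zero.2 hd
  have h1 : volume (scaledDomain Δ d) = volume (((d : ℝ) • ·) ⁻¹' Δ) :=
    (EuclideanSpace.volume_preserving_symm_measurableEquiv_toLp
      (Fin n)).symm.measure_preimage_equiv _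
  rw [measureReal_def, h1, Measure.addHaar_preimage_smul _ hd', ENNReal.toReal_mul,
    ENNReal.toReal_ofReal (abs_nonneg _), finrank_euclideanSpace_fin,
    abs_of_nonneg (by positivity), one_div]

theorem convex_scaledDomain {n : ℕ} {Δ : Set (EuclideanSpace ℝ (Fin n))} (h : Convex ℝ Δ)
    (d : ℕ) : Convex ℝ (scaledDomain Δ d) := by
  have h1 := h.smul_preimage (d : ℝ)
  exact h1.linear_preimage (WithLp.linearEquiv 2 ℝ (Fin n → ℝ)).symm.toLinearMap

/-- Since `d ≥ 1`, rescaling does not increase distances. The side `2 * Metric.diam Δ` is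
independent of `d`, which makes the error uniform in `d`. -/
theorem scaledDomain_subset_Icc {n : ℕ} {Δ : Set (EuclideanSpace ℝ (Fin n))}
    (h : Bornology.IsBounded Δ) {c : EuclideanSpace ℝ (Fin n)} (hc : c ∈ Δ)
    {d : ℕ} (hd : d ≠ 0) :
    scaledDomain Δ d ⊆ Set.Icc (fun i => c i / d - Metric.diam Δ)
      (fun i => c i / d - Metric.diam Δ + 2 * Metric.diam Δ) := by
  intro y hy
  have hd1 : (1 : ℝ) ≤ d := Nat.one_le_cast.2 (Nat.one_le_iff_ne_zero.2 hd)
  have h1 : ∀ i, |y i - c i / d| ≤ Metric.diam Δ := by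
    intro i
    have h2 : ‖((d : ℝ) • WithLp.toLp 2 y - c) i‖ ≤ Metric.diam Δ :=
      (PiLp.norm_apply_le _ i).trans
        ((dist_eq_norm _ _).symm.le.trans (Metric.dist_le_diam_of_mem h hy hc))
    have h3 : ((d : ℝ) • WithLp.toLp 2 y - c) i = d * (y i - c i / d) := by
      simp only [PiLp.sub_apply, PiLp.smul_apply, smul_eq_mul]
      field_simp
    rw [h3, Real.norm_eq_abs, abs_mul, Nat.abs_cast] at h2
    exact (le_mul_of_one_le_left (abs_nonneg _) hd1).trans h2
  constructor <;> intro i <;> have := abs_le.1 (h1 i) <;> dsimp only <;> linarith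

theorem isCompact_scaledDomain {n : ℕ} {Δ : Set (EuclideanSpace ℝ (Fin n))} (h : IsCompact Δ)
    {d : ℕ} (hd : d ≠ 0) : IsCompact (scaledDomain Δ d) := by
  have hcl : IsClosed (scaledDomain Δ d) :=
    (h.isClosed.preimage (continuous_const_smul (d : ℝ))).preimage (PiLp.continuous_toLp 2 _)
  rcases Δ.eq_empty_or_nonempty with rfl | ⟨c, hc⟩
  · simp [scaledDomain]
  · exact isCompact_Icc.of_isClosed_subset hcl (scaledDomain_subset_Icc h.isBounded hc hd)

theorem ncard_latticePoints_dvd {n : ℕ} (Δ : Set (EuclideanSpace ℝ (Fin n))) {d : ℕ}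
    (hd : d ≠ 0) :
    {x ∈ latticePoints Δ | ∀ i, (d : ℤ) ∣ x i}.ncard =
      (integerPoints (scaledDomain Δ d)).ncard := by
  have hd' : (d : ℤ) ≠ 0 := Nat.cast_ne_zero.2 hd
  have key : ∀ y : Fin n → ℤ, latticePoint (fun i => (d : ℤ) * y i) =
      (d : ℝ) • WithLp.toLp 2 (fun i => (y i : ℝ)) := by
    intro y; ext i; simp [latticePoint]
  have : {x ∈ latticePoints Δ | ∀ i, (d : ℤ) ∣ x i} =
      (fun (y : Fin n → ℤ) i => (d : ℤ) * y i) '' integerPoints (scaledDomain Δ d) := by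
    ext x
    constructor
    · rintro ⟨hx, hdx⟩
      choose y hy using hdx
      obtain rfl : x = fun i => (d : ℤ) * y i := funext hy
      refine ⟨y, ?_, rfl⟩
      have : latticePoint (fun i => (d : ℤ) * y i) ∈ Δ := hx
      rwa [key] at this
    · rintro ⟨y, hy, rfl⟩
      refine ⟨?_, fun i => dvd_mul_right _ _⟩
      change latticePoint _ ∈ Δ
      rw [key]
      exact hy
  rw [this, Set.ncard_image_of_injective]
  intro y z h
  ext i
  exact mul_left_cancel₀ hd' (congrFun h i)

theorem abs_ncard_latticePoints_dvd_sub_le {n : ℕ} {Δ : Set (EuclideanSpace ℝ (Fin n))}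
    (hΔ : IsConvexDomain Δ) (hdiam : 1 ≤ Metric.diam Δ) {d : ℕ} (hd : d ≠ 0) :
    |({x ∈ latticePoints Δ | ∀ i, (d : ℤ) ∣ x i}.ncard : ℝ) -
      1 / (d : ℝ) ^ n * (volume Δ).toReal| ≤ n * 3 ^ (n - 1) * Metric.diam Δ ^ (n - 1) := by
  obtain ⟨c, hc⟩ := hΔ.nonempty_interior.mono interior_subset
  rw [ncard_latticePoints_dvd Δ hd, ← volume_real_scaledDomain hd, mul_assoc, ← mul_pow]
  refine (abs_ncard_integerPoints_sub_volume_le (convex_scaledDomain hΔ.convex d)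
    (isCompact_scaledDomain hΔ.isCompact hd) (by linarith)
    (scaledDomain_subset_Icc hΔ.isCompact.isBounded hc hd)).trans ?_
  -- What remains is `2ω + 1 ≤ 3ω`, the source of the `3` and the use of `ω ≥ 1`.
  gcongr
  linarith

theorem latticePoints_finite {n : ℕ} {Δ : Set (EuclideanSpace ℝ (Fin n))}
    (h : IsCompact Δ) : (latticePoints Δ).Finite := by
  rcases Δ.eq_empty_or_nonempty with rfl | ⟨c, hc⟩
  · simp [latticePoints]
  · refine (integerPoints_finite (scaledDomain_subset_Icc h.isBounded hc one_ne_zero)).subset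
      fun x hx => ?_
    change ((1 : ℕ) : ℝ) • latticePoint x ∈ Δ
    rw [Nat.cast_one, one_smul]
    exact hx

theorem ncard_coprimePoints_eq_sum {n : ℕ} {Δ : Set (EuclideanSpace ℝ (Fin n))}
    (h : (latticePoints Δ).Finite) {b : ℤ} (hb : b ≠ 0) :
    ((coprimePoints Δ b).ncard : ℝ) = ∑ s ∈ b.natAbs.primeFactors.powerset, (-1 : ℝ) ^ s.card *
      ({x ∈ latticePoints Δ | ∀ i, ((∏ p ∈ s, p : ℕ) : ℤ) ∣ x i}.ncard : ℝ) := by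
  classical
  have hcard : ∀ q : (Fin n → ℤ) → Prop, ({x ∈ latticePoints Δ | q x}.ncard : ℝ) =
      ∑ x ∈ h.toFinset, if q x then 1 else 0 := by
    intro q
    rw [Finset.sum_boole, ← Set.ncard_coe_finset]
    congr 2
    ext x
    simp
  rw [coprimePoints, hcard]
  simp only [hcard, gcdWith_eq_one_iff _ hb, Finset.mul_sum]
  rw [Finset.sum_comm]
  refine Finset.sum_congr rfl fun x _ => ?_
  convert indicator_coprime_eq_sum (fun p hp => Nat.prime_of_mem_primeFactors hp) x

theorem theorem2p1 (n : ℕ) (hn : 1 ≤ n) (b : ℤ) (hb : b ≠ 0) :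
    ∃ C : ℝ, ∀ Δ : Set (EuclideanSpace ℝ (Fin n)),
      IsConvexDomain Δ → 1 ≤ Metric.diam Δ →
        (coprimePoints Δ b).Finite ∧
        |((coprimePoints Δ b).ncard : ℝ) -
            (∏ p ∈ b.natAbs.primeFactors, (1 - 1 / (p : ℝ) ^ n)) * (volume Δ).toReal|
          ≤ C * Metric.diam Δ ^ (n - 1) := by
  -- One error term `n * 3 ^ (n - 1)` for each set of primes dividing `b`.
  refine ⟨b.natAbs.primeFactors.powerset.card * (n * 3 ^ (n - 1)), fun Δ hΔ hdiam => ?_⟩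
  have hfin := latticePoints_finite hΔ.isCompact
  refine ⟨hfin.subset (Set.sep_subset _ _), ?_⟩
  rw [ncard_coprimePoints_eq_sum hfin hb, prod_one_sub_inv_pow_eq_sum, Finset.sum_mul,
    ← Finset.sum_sub_distrib, mul_assoc, ← nsmul_eq_mul]
  refine (Finset.abs_sum_le_sum_abs _ _).trans (Finset.sum_le_card_nsmul _ _ _ fun s hs => ?_)
  have hd : (∏ p ∈ s, p) ≠ 0 := Finset.prod_ne_zero_iff.2 fun p hp =>
    (Nat.prime_of_mem_primeFactors (Finset.mem_powerset.1 hs hp)).ne_zero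
  rw [mul_assoc, ← mul_sub, abs_mul, abs_pow, abs_neg, abs_one, one_pow, one_mul]
  exact abs_ncard_latticePoints_dvd_sub_le hΔ hdiam hd
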